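/- For positive integers $q_1,q_2$ and reals $X_1,X_2>0$ put $$\mathcal A_{q_1,q_2}(X_1,X_2)=\{x_1q_1+x_2q_2 : x_1,x_2\in\mathbb Z,\ |x_1|\le X_1,\ |x_2|\le X_2\}.$$ It is called proper if each of its elements has only one such representation. Call $(q_1,q_2,X_1,X_2)$ good for $T$ if $q_1,q_2$ are coprime and $\mathcal A_{q_1,q_2}(X_1,X_2)$ is proper, is contained in $[-T,T]$ and contains no non-zero perfect square. For an odd prime $p$ let $n(p)$ be the least quadratic non-residue modulo $p$. Say that a real $\theta$ is an admissible exponent for coprime (respectively, proper) progressions if for every $\varepsilon>0$ there is a $C$ such that $|\mathcal A_{q_1,q_2}(X_1,X_2)|\le C\,T^{\theta+\varepsilon}$ for all $T\ge 1$ and all $\mathcal A_{q_1,q_2}(X_1,X_2)\subseteq[-T,T]$ without non-zero perfect square for which $q_1,q_2$ are coprime (respectively, for which the progression is proper). (1) For every prime $p\equiv 1\pmod 4$ there is an integer $q$ with $p\le q<2p$ that is a quadratic non-residue modulo $p$. For every such $p$ and $q$, with $T=2p^2$, the data $(p,q,p-1,n(p)-1)$ are good for $T$, and $|\mathcal A_{p,q}(p-1,n(p)-1)|\ge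 T^{1/2}n(p)$. (2) There are a constant $c>0$, a sequence $T_i\to\infty$, and for each $i$ data $(q_1^{(i)},q_2^{(i)},X_1^{(i)},X_2^{(i)})$ good for $T_i$ with $$|\mathcal A_{q_1^{(i)},q_2^{(i)}}(X_1^{(i)},X_2^{(i)})|\ge c\,T_i^{1/2}\log T_i .$$ (3) Every exponent $\theta$ that is admissible for coprime or for proper progressions satisfies $\theta\ge\frac12$. (4) For all real $\alpha$ and $c>0$ there is a $c'>0$ such that, if $n(p)\ge c\,p^{\alpha}$ for infinitely many primes $p\equiv1\pmod 4$, then there are arbitrarily large $T$ of the form $T=2p^2$ with $p\equiv 1\pmod 4$ prime, and quadratic non-residues $q$ modulo $p$ with $p\le q<2p$, such that $(p,q,p-1,n(p)-1)$ are good for $T$ and $|\mathcal A_{p,q}(p-1,n(p)-1)|\ge c'\,T^{(1+\alpha)/2}$. (5) If some $\theta<\frac12+\frac1{8\sqrt e}$ is admissible for coprime or for proper progressions, then Burgess's exponent $\frac1{4\sqrt e}$ for the least quadratic non-residue can be improved for primes $p\equiv1\pmod4$: there is a $\beta<\frac1{4\sqrt e}$ such that for every $\varepsilon>0$ there is a $C$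 with $n(p)\le C\,p^{\beta+\varepsilon}$ for all primes $p\equiv1\pmod 4$. -/

import Mathlib

namespace SquareAP

/-- The symmetric two-dimensional progression
`{x₁ q₁ + x₂ q₂ : x₁, x₂ ∈ ℤ, |x₁| ≤ X₁, |x₂| ≤ X₂}`. -/
def progression (q₁ q₂ : ℕ) (X₁ X₂ : ℝ) : Set ℤ :=
  {a | ∃ x₁ x₂ : ℤ, |(x₁ : ℝ)| ≤ X₁ ∧ |(x₂ : ℝ)| ≤ X₂ ∧ a = x₁ * q₁ + x₂ * q₂}

/-- Every element of the progression is represented uniquely. -/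
def IsProper (q₁ q₂ : ℕ) (X₁ X₂ : ℝ) : Prop :=
  ∀ x₁ x₂ y₁ y₂ : ℤ, |(x₁ : ℝ)| ≤ X₁ → |(x₂ : ℝ)| ≤ X₂ → |(y₁ : ℝ)| ≤ X₁ → |(y₂ : ℝ)| ≤ X₂ →
    x₁ * q₁ + x₂ * q₂ = y₁ * q₁ + y₂ * q₂ → x₁ = y₁ ∧ x₂ = y₂

/-- The set lies in the interval `[-T, T]`. -/
def ContainedIn (A : Set ℤ) (T : ℝ) : Prop := ∀ a ∈ A, |(a : ℝ)| ≤ T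

/-- The set contains no non-zero perfect square. -/
def AvoidsSquares (A : Set ℤ) : Prop := ∀ a ∈ A, IsSquare a → a = 0

/-- A proper symmetric two-dimensional progression with coprime positive generators, contained
in `[-T, T]` and free of non-zero squares. -/
def IsGood (q₁ q₂ : ℕ) (X₁ X₂ T : ℝ) : Prop :=
  0 < q₁ ∧ 0 < q₂ ∧ Nat.Coprime q₁ q₂ ∧ 0 < X₁ ∧ 0 < X₂ ∧
    ContainedIn (progression q₁ q₂ X₁ X₂) T ∧ AvoidsSquares (progression q₁ q₂ X₁ X₂) ∧
    IsProper q₁ q₂ X₁ X₂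

/-- The upper bound `≪_ε T^(θ+ε)` for square-avoiding progressions with coprime generators. -/
def CoprimeUpperExponent (θ : ℝ) : Prop :=
  ∀ ε : ℝ, 0 < ε → ∃ C : ℝ, ∀ (q₁ q₂ : ℕ) (X₁ X₂ T : ℝ), 0 < q₁ → 0 < q₂ → Nat.Coprime q₁ q₂ →
    0 < X₁ → 0 < X₂ → 1 ≤ T → ContainedIn (progression q₁ q₂ X₁ X₂) T →
    AvoidsSquares (progression q₁ q₂ X₁ X₂) →
    ((progression q₁ q₂ X₁ X₂).ncard : ℝ) ≤ C * T ^ (θ + ε)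

/-- The upper bound `≪_ε T^(θ+ε)` for square-avoiding proper progressions. -/
def ProperUpperExponent (θ : ℝ) : Prop :=
  ∀ ε : ℝ, 0 < ε → ∃ C : ℝ, ∀ (q₁ q₂ : ℕ) (X₁ X₂ T : ℝ), 0 < q₁ → 0 < q₂ → IsProper q₁ q₂ X₁ X₂ →
    0 < X₁ → 0 < X₂ → 1 ≤ T → ContainedIn (progression q₁ q₂ X₁ X₂) T →
    AvoidsSquares (progression q₁ q₂ X₁ X₂) →
    ((progression q₁ q₂ X₁ X₂).ncard : ℝ) ≤ C * T ^ (θ + ε)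

/-- The least quadratic non-residue modulo `p` (meaningful for odd primes `p`). -/
noncomputable def leastNonresidue (p : ℕ) : ℕ := sInf {n : ℕ | ¬ IsSquare (n : ZMod p)}

/-- `p` is a prime `≡ 1 (mod 4)` and `q` is a quadratic non-residue modulo `p` in `[p, 2p)`. -/
def IsPair (p q : ℕ) : Prop :=
  p.Prime ∧ p % 4 = 1 ∧ p ≤ q ∧ q < 2 * p ∧ ¬ IsSquare (q : ZMod p)

/-- The bound `n(p) ≪_ε p^(β+ε)` for the least quadratic non-residue, for all primes
`p ≡ 1 (mod 4)`; Burgess's bound is the case `β = 1 / (4 √e)`. -/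
def NonresidueExponent (β : ℝ) : Prop :=
  ∀ ε : ℝ, 0 < ε → ∃ C : ℝ, ∀ p : ℕ, p.Prime → p % 4 = 1 →
    (leastNonresidue p : ℝ) ≤ C * (p : ℝ) ^ (β + ε)

end SquareAP

namespace SquareAP

/-! Take the first generator to be a squarefree `m` and `X₁ = m - 1`. A square `x * m + y * q` makes
`y * q` a square modulo `m`. If `q` is chosen so that this never happens for `0 < |y| ≤ X`, then `y
= 0`, and a square `x * m` with `|x| < m` must be zero. The progression has about `4 * m * X`
elements and lies in `[-T, T]` with `T = 2 * m ^ 2`, so its size is of order `T ^ (1/2) * X`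
(`isGood_of_squarefree`, `le_ncard_progression`).

For prime `m = p ≡ 1 (mod 4)`, `-1` is a residue, so every `y` with `0 < |y| < n(p)` is one, and any
non-residue `q` works. Hence an upper exponent `θ` forces `n(p) ≪ p ^ (2 * θ - 1 + ε)`.

Unconditionally, `m` is a product of many primes and `q` comes from pigeonhole and the Chinese
remainder theorem (`exists_forall_not_isSquare`). The resulting logarithmic gain also excludes
exponents below `1/2`. -/

lemma progression_natCast_eq_image (q₁ q₂ a b : ℕ) :
    progression q₁ q₂ a b =
      (fun x : ℤ × ℤ => x.1 * q₁ + x.2 * q₂) ''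
        (Finset.Icc (-a : ℤ) a ×ˢ Finset.Icc (-b : ℤ) b : Finset (ℤ × ℤ)) := by
  ext n
  simp only [progression, Set.mem_ofPred_eq, Set.mem_image, Finset.coe_product, Set.mem_prod,
    Finset.coe_Icc, Set.mem_Icc, Prod.exists, ← abs_le]
  constructor
  · rintro ⟨x, y, hx, hy, rfl⟩
    exact ⟨x, y, ⟨by exact_mod_cast hx, by exact_mod_cast hy⟩, rfl⟩
  · rintro ⟨x, y, ⟨hx, hy⟩, rfl⟩
    exact ⟨x, y, by exact_mod_cast hx, by exact_mod_cast hy, rfl⟩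

lemma IsProper.ncard_progression {q₁ q₂ a b : ℕ} (h : IsProper q₁ q₂ a b) :
    (progression q₁ q₂ a b).ncard = (2 * a + 1) * (2 * b + 1) := by
  rw [progression_natCast_eq_image, Set.InjOn.ncard_image, Set.ncard_coe_finset,
    Finset.card_product, Int.card_Icc, Int.card_Icc]
  · congr 1 <;> omega
  · rintro ⟨x₁, x₂⟩ hx ⟨y₁, y₂⟩ hy hxy
    simp only [Finset.coe_product, Set.mem_prod, Finset.coe_Icc, Set.mem_Icc, ← abs_le] at hx hy
    obtain ⟨h₁, h₂⟩ := h x₁ x₂ y₁ y₂ (by exact_mod_cast hx.1) (by exact_mod_cast hx.2)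
      (by exact_mod_cast hy.1) (by exact_mod_cast hy.2) hxy
    rw [h₁, h₂]

/-- The condition `2 * X < m` serves twice: it keeps the progression within `2 * m ^ 2`, and it
gives properness, since `m` divides `x₂ - y₂`, of absolute value at most `2 * X`. -/
lemma isGood_of_squarefree {m q X : ℕ} (hm : Squarefree m) (hq : 0 < q) (hqm : q < 2 * m)
    (hcop : m.Coprime q) (hX : 0 < X) (hXm : 2 * X < m)
    (hns : ∀ x : ℤ, x ≠ 0 → |x| ≤ X → ¬ IsSquare ((x * q : ℤ) : ZMod m)) :
    IsGood m q ((m : ℝ) - 1) X (2 * (m : ℝ) ^ 2) := by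
  have hcast : (m : ℝ) - 1 = ((m - 1 : ℕ) : ℝ) := by
    rw [Nat.cast_sub (by omega), Nat.cast_one]
  have hm_cast : ∀ {x : ℤ}, |(x : ℝ)| ≤ (m : ℝ) - 1 → |x| ≤ (m : ℤ) - 1 := fun h => by
    exact_mod_cast h
  have hX_cast : ∀ {x : ℤ}, |(x : ℝ)| ≤ (X : ℝ) → |x| ≤ (X : ℤ) := fun h => by exact_mod_cast h
  refine ⟨by omega, hq, hcop, ?_, by exact_mod_cast hX, ?_, ?_, ?_⟩
  · rw [hcast]; exact_mod_cast (by omega : 0 < m - 1)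
  · rintro a ⟨x, y, hx, hy, rfl⟩
    replace hx := hm_cast hx
    replace hy := hX_cast hy
    have h : |x * m + y * q| ≤ 2 * (m : ℤ) ^ 2 := by
      calc |x * m + y * q| ≤ |x| * m + |y| * q := by
            refine (abs_add_le _ _).trans_eq ?_
            rw [abs_mul, abs_mul, Nat.abs_cast, Nat.abs_cast]
        _ ≤ ((m : ℤ) - 1) * m + X * (2 * m) := by gcongr; exact_mod_cast hqm.le
        _ ≤ 2 * (m : ℤ) ^ 2 := by
            have : (2 * X : ℤ) < m := by exact_mod_cast hXm
            nlinarith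
    exact_mod_cast h
  · rintro a ⟨x, y, hx, hy, rfl⟩ hsq
    replace hx := hm_cast hx
    by_cases hy0 : y = 0
    · subst hy0
      simp only [zero_mul, add_zero] at hsq ⊢
      obtain ⟨r, hr⟩ := hsq
      have hmZ : Squarefree (m : ℤ) := Int.squarefree_natCast.mpr hm
      -- From `x * m = r ^ 2` and `m` squarefree, `m ∣ r`; then `m ∣ x`, so `|x| < m` leaves only `x
      -- = 0`.
      obtain ⟨s, rfl⟩ : (m : ℤ) ∣ r := by
        refine (hmZ.dvd_pow_iff_dvd two_ne_zero).mp ?_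
        rw [pow_two, ← hr]
        exact dvd_mul_left _ _
      have hm0 : (m : ℤ) ≠ 0 := by omega
      have hxm : (m : ℤ) ∣ x := ⟨s * s, mul_right_cancel₀ hm0 (by rw [hr]; ring)⟩
      rw [Int.eq_zero_of_abs_lt_dvd hxm (by omega), zero_mul]
    · exfalso
      refine hns y hy0 (hX_cast hy) ?_
      have := hsq.map (Int.castRingHom (ZMod m))
      simpa using this
  · intro x₁ x₂ y₁ y₂ _ hx₂ _ hy₂ h
    replace hx₂ := abs_le.mp (hX_cast hx₂)
    replace hy₂ := abs_le.mp (hX_cast hy₂)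
    have hdvd : (m : ℤ) ∣ x₂ - y₂ := by
      have : (m : ℤ) ∣ (x₂ - y₂) * q := ⟨y₁ - x₁, by linear_combination h⟩
      exact (Nat.isCoprime_iff_coprime.mpr hcop).dvd_of_dvd_mul_right this
    have h2 : x₂ - y₂ = 0 := Int.eq_zero_of_abs_lt_dvd hdvd (abs_lt.mpr (by omega))
    have h2 : x₂ = y₂ := by omega
    subst h2
    have hm0 : (m : ℤ) ≠ 0 := by omega
    exact ⟨mul_right_cancel₀ hm0 (by linear_combination h), rfl⟩

lemma sqrt_two_mul_sq (m : ℕ) : (2 * (m : ℝ) ^ 2) ^ (1 / 2 : ℝ) = √2 * m := by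
  rw [← Real.sqrt_eq_rpow, Real.sqrt_mul zero_le_two, Real.sqrt_sq (Nat.cast_nonneg m)]

lemma le_ncard_progression {m q X : ℕ} (hm : 5 ≤ m) (hX : 1 ≤ X)
    (h : IsProper m q ((m : ℝ) - 1) X) :
    (2 * (m : ℝ) ^ 2) ^ (1 / 2 : ℝ) * ((X : ℝ) + 1) ≤
      ((progression m q ((m : ℝ) - 1) X).ncard : ℝ) := by
  have hcast : (m : ℝ) - 1 = ((m - 1 : ℕ) : ℝ) := by
    rw [Nat.cast_sub (by omega), Nat.cast_one]
  rw [hcast] at h ⊢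
  rw [h.ncard_progression, sqrt_two_mul_sq]
  push_cast
  rw [← hcast]
  have hm' : (5 : ℝ) ≤ m := by exact_mod_cast hm
  have hX' : (1 : ℝ) ≤ X := by exact_mod_cast hX
  have h2 : √2 ≤ 3 / 2 := Real.sqrt_le_iff.mpr (by norm_num)
  -- Here `2 * m - 1 ≥ m`, and `X ≥ 1` gives `2 * X + 1 ≥ 3 / 2 * (X + 1)`.
  calc √2 * m * ((X : ℝ) + 1) ≤ 3 / 2 * m * (X + 1) := by gcongr
    _ ≤ (2 * (m - 1) + 1) * (2 * X + 1) := by nlinarith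

/-! ### The least non-residue and the construction with a prime generator. -/

section LeastNonresidue

variable {p : ℕ}

lemma exists_natCast_not_isSquare (hp : p.Prime) (h2 : p ≠ 2) :
    ∃ n : ℕ, ¬ IsSquare (n : ZMod p) := by
  have := Fact.mk hp
  obtain ⟨a, ha⟩ := FiniteField.exists_nonsquare (F := ZMod p) (by rwa [ZMod.ringChar_zmod_n])
  exact ⟨a.val, by rwa [ZMod.natCast_zmod_val]⟩

lemma leastNonresidue_spec (hp : p.Prime) (h2 : p ≠ 2) :
    ¬ IsSquare (leastNonresidue p : ZMod p) :=
  Nat.sInf_mem (exists_natCast_not_isSquare hp h2)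

lemma leastNonresidue_le {n : ℕ} (h : ¬ IsSquare (n : ZMod p)) : leastNonresidue p ≤ n :=
  Nat.sInf_le h

lemma isSquare_of_lt_leastNonresidue {n : ℕ} (h : n < leastNonresidue p) :
    IsSquare (n : ZMod p) := by
  by_contra hn
  exact absurd (leastNonresidue_le hn) (by omega)

lemma two_le_leastNonresidue (hp : p.Prime) (h2 : p ≠ 2) : 2 ≤ leastNonresidue p := by
  have h := leastNonresidue_spec hp h2
  by_contra hlt
  obtain h0 | h1 : leastNonresidue p = 0 ∨ leastNonresidue p = 1 := by omega
  · exact h (by rw [h0]; simp)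
  · exact h (by rw [h1]; simp)

lemma leastNonresidue_lt (hp : p.Prime) (h2 : p ≠ 2) : leastNonresidue p < p := by
  have := Fact.mk hp
  obtain ⟨n, hn⟩ := exists_natCast_not_isSquare hp h2
  refine (leastNonresidue_le (n := (n : ZMod p).val) ?_).trans_lt (ZMod.val_lt _)
  rwa [ZMod.natCast_zmod_val]

lemma isSquare_neg_one_of_mod_four (hp : p.Prime) (h4 : p % 4 = 1) :
    IsSquare (-1 : ZMod p) := by
  have := Fact.mk hp
  exact ZMod.exists_sq_eq_neg_one_iff.mpr (by omega)

/-- Since `-1` is a residue, `p - n(p)` is again a non-residue. This supplies `2 * X < p` for `X =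
n(p) - 1`. -/
lemma two_mul_leastNonresidue_le (hp : p.Prime) (h4 : p % 4 = 1) :
    2 * leastNonresidue p ≤ p := by
  have h2 : p ≠ 2 := by omega
  have hlt := leastNonresidue_lt hp h2
  have : leastNonresidue p ≤ p - leastNonresidue p := by
    refine leastNonresidue_le fun h => leastNonresidue_spec hp h2 ?_
    have := (isSquare_neg_one_of_mod_four hp h4).mul h
    rwa [Nat.cast_sub hlt.le, ZMod.natCast_self, zero_sub, neg_one_mul, neg_neg] at this
  omega

end LeastNonresidue

lemma not_isSquare_mul {F : Type*} [Field F] {a b : F} (ha : a ≠ 0) (hsq : IsSquare a)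
    (hb : ¬ IsSquare b) : ¬ IsSquare (a * b) := fun h =>
  hb (by simpa [mul_div_cancel_left₀ b ha] using h.div hsq)

lemma exists_isPair {p : ℕ} (hp : p.Prime) (h4 : p % 4 = 1) : ∃ q, IsPair p q := by
  have h2 : p ≠ 2 := by omega
  have := leastNonresidue_lt hp h2
  refine ⟨p + leastNonresidue p, hp, h4, by omega, by omega, ?_⟩
  simpa using leastNonresidue_spec hp h2

lemma IsPair.isGood_and_le_ncard {p q : ℕ} (h : IsPair p q) :
    IsGood p q ((p : ℝ) - 1) ((leastNonresidue p : ℝ) - 1) (2 * (p : ℝ) ^ 2) ∧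
      (2 * (p : ℝ) ^ 2) ^ (1 / 2 : ℝ) * (leastNonresidue p : ℝ) ≤
        ((progression p q ((p : ℝ) - 1) ((leastNonresidue p : ℝ) - 1)).ncard : ℝ) := by
  obtain ⟨hp, h4, hpq, hq2, hq⟩ := h
  have := Fact.mk hp
  have h2 : p ≠ 2 := by omega
  have hn2 := two_le_leastNonresidue hp h2
  have hnp := two_mul_leastNonresidue_le hp h4
  have hp5 : 5 ≤ p := by have := hp.two_le; omega
  obtain ⟨X, hX⟩ : ∃ X, leastNonresidue p = X + 1 := ⟨leastNonresidue p - 1, by omega⟩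
  have hcast : (leastNonresidue p : ℝ) - 1 = X := by rw [hX]; push_cast; ring
  have hgood : IsGood p q ((p : ℝ) - 1) X (2 * (p : ℝ) ^ 2) := by
    refine isGood_of_squarefree hp.squarefree (by omega) hq2 ?_ (by omega) (by omega) ?_
    · refine (Nat.Prime.coprime_iff_not_dvd hp).mpr fun hd => hq ?_
      rw [(ZMod.natCast_eq_zero_iff q p).mpr hd]
      exact IsSquare.zero
    · intro x hx0 hxX
      rw [Int.cast_mul, Int.cast_natCast]
      refine not_isSquare_mul (fun h0 => hx0 ?_) ?_ hq
      · exact Int.eq_zero_of_abs_lt_dvd ((ZMod.intCast_zmod_eq_zero_iff_dvd x p).mp h0)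
          (by omega)
      · have hsq : IsSquare (x.natAbs : ZMod p) := isSquare_of_lt_leastNonresidue (by
          rw [Int.abs_eq_natAbs] at hxX; omega)
        obtain hx | hx := Int.natAbs_eq x
        · rw [hx]; simpa using hsq
        · rw [hx]
          simpa using (isSquare_neg_one_of_mod_four hp h4).mul hsq
  rw [hcast]
  refine ⟨hgood, ?_⟩
  have := le_ncard_progression hp5 (by omega) hgood.2.2.2.2.2.2.2
  rwa [hX, Nat.cast_add, Nat.cast_one]

/-! ### The unconditional logarithmic gain. -/

lemma exists_primes_dyadic (j : ℕ) :
    ∃ p : ℕ → ℕ, ∀ i, (p i).Prime ∧ 2 ^ (j + i) < p i ∧ p i ≤ 2 ^ (j + i + 1) := by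
  have h : ∀ i, ∃ p : ℕ, p.Prime ∧ 2 ^ (j + i) < p ∧ p ≤ 2 ^ (j + i + 1) := fun i => by
    obtain ⟨p, hp, h₁, h₂⟩ := Nat.exists_prime_lt_and_le_two_mul (2 ^ (j + i)) (by positivity)
    exact ⟨p, hp, h₁, by rwa [pow_succ']⟩
  choose p hp using h
  exact ⟨p, hp⟩

/-- If the number of sign patterns exceeds the number of multipliers `x` with `|x| ≤ X`, some `q`
makes every `x * q` a non-residue modulo one of the primes `p i`. -/
lemma exists_forall_not_isSquare {k X : ℕ} (p : Fin k → ℕ) (hp : ∀ i, (p i).Prime)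
    (hodd : ∀ i, p i ≠ 2) (hinj : Function.Injective p) (hX : ∀ i, X < p i)
    (hk : 2 * X + 1 < 2 ^ k) :
    ∃ q : ℕ, q < ∏ i, p i ∧ (∏ i, p i).Coprime q ∧
      ∀ x : ℤ, x ≠ 0 → |x| ≤ X → ¬ IsSquare ((x * q : ℤ) : ZMod (∏ i, p i)) := by
  classical
  have : ∀ i, Fact (p i).Prime := fun i => ⟨hp i⟩
  have hpair : Pairwise (Function.onFun Nat.Coprime p) := fun i j hij =>
    (Nat.coprime_primes (hp i) (hp j)).mpr (hinj.ne hij)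
  have : NeZero (∏ i, p i) := ⟨Finset.prod_ne_zero_iff.mpr fun i _ => (hp i).ne_zero⟩
  let pattern : ℤ → Fin k → Bool := fun x i => decide (IsSquare (x : ZMod (p i)))
  obtain ⟨ε, hε⟩ : ∃ ε, ε ∉ (Finset.Icc (-X : ℤ) X).image pattern := by
    by_contra! h
    have hcard := Finset.card_image_le (s := Finset.Icc (-X : ℤ) X) (f := pattern)
    rw [Finset.eq_univ_iff_forall.mpr h, Finset.card_univ, Fintype.card_fun, Fintype.card_bool,
      Fintype.card_fin, Int.card_Icc] at hcard
    omega
  -- The `q` to be built realises the missing pattern `ε` by units, so it is also coprime to the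
  -- product.
  have hr : ∀ i, ∃ r : ZMod (p i), r ≠ 0 ∧ (IsSquare r ↔ ε i = true) := fun i => by
    cases h : ε i
    · obtain ⟨r, hr⟩ := FiniteField.exists_nonsquare (F := ZMod (p i))
        (by rw [ZMod.ringChar_zmod_n]; exact hodd i)
      exact ⟨r, by rintro rfl; exact hr IsSquare.zero, by simpa using hr⟩
    · exact ⟨1, one_ne_zero, by simp⟩
  choose r hr0 hr using hr
  let e := ZMod.prodEquivPi p hpair
  let q := (e.symm r).val
  have hq : ∀ i, (q : ZMod (p i)) = r i := fun i => by
    have h1 : ((q : ℕ) : ZMod (∏ i, p i)) = e.symm r := ZMod.natCast_zmod_val _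
    have h2 := congrArg e h1
    rw [map_natCast, RingEquiv.apply_symm_apply] at h2
    simpa using congrFun h2 i
  refine ⟨q, ZMod.val_lt _, ?_, fun x hx0 hxX hsq => ?_⟩
  · refine Nat.Coprime.prod_left fun i _ => ((hp i).coprime_iff_not_dvd).mpr fun hd => hr0 i ?_
    rw [← hq i, (ZMod.natCast_eq_zero_iff q (p i)).mpr hd]
  · have hne : pattern x ≠ ε := fun h =>
      hε (Finset.mem_image.mpr ⟨x, Finset.mem_Icc.mpr (abs_le.mp hxX), h⟩)
    -- At a prime where the patterns of `x` and `q` differ, exactly one of these two units is a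
    -- residue, so `x * q` is not.
    obtain ⟨i, hi⟩ := Function.ne_iff.mp hne
    have hx : (x : ZMod (p i)) ≠ 0 := fun h0 => hx0 <|
      Int.eq_zero_of_abs_lt_dvd ((ZMod.intCast_zmod_eq_zero_iff_dvd x (p i)).mp h0)
        (by have := hX i; omega)
    have hsqi : IsSquare ((x : ZMod (p i)) * r i) := by
      have hd : p i ∣ ∏ i, p i := Finset.dvd_prod_of_mem p (Finset.mem_univ i)
      have := hsq.map (ZMod.castHom hd (ZMod (p i)))
      rw [map_intCast, Int.cast_mul, Int.cast_natCast, hq i] at this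
      exact this
    by_cases hxs : IsSquare (x : ZMod (p i))
    · refine not_isSquare_mul hx hxs (fun hrs => hi ?_) hsqi
      rw [(hr i).mp hrs]
      exact decide_eq_true hxs
    · refine not_isSquare_mul (hr0 i) ?_ hxs (by rwa [mul_comm])
      by_contra hrs
      refine hi ?_
      rw [Bool.eq_false_iff.mpr (mt (hr i).mpr hrs)]
      exact decide_eq_false hxs

/-- Only `4 * (j + 2) ^ 2 + 1` is needed later; the linear term ensures that the left side at most
doubles at each step, which would fail at `j = 0` without it. -/
lemma quadratic_le_two_pow (j : ℕ) : 4 * (j + 2) ^ 2 + 8 * (j + 2) + 1 ≤ 64 * 2 ^ j := by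
  induction j with
  | zero => norm_num
  | succ n ih => rw [pow_succ 2 n]; nlinarith

/-- With `j + 2` primes there are `4 * 2 ^ j` patterns, enough for `X = 2 ^ j`. The primes are at
most `2 ^ (2 * (j + 2))`, so `log T` is only quadratic in `j`, and `X` dominates it with room to
spare. -/
lemma exists_isGood_log (j : ℕ) :
    ∃ m q : ℕ, j ≤ m ∧
      IsGood m q ((m : ℝ) - 1) ((2 ^ j : ℕ) : ℝ) (2 * (m : ℝ) ^ 2) ∧
      1 / 64 * ((2 * (m : ℝ) ^ 2) ^ (1 / 2 : ℝ) * Real.log (2 * (m : ℝ) ^ 2)) ≤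
        ((progression m q ((m : ℝ) - 1) ((2 ^ j : ℕ) : ℝ)).ncard : ℝ) := by
  obtain ⟨P, hP⟩ := exists_primes_dyadic (j + 2)
  let p : Fin (j + 2) → ℕ := fun i => P i
  have hmono : StrictMono P := strictMono_nat_of_lt_succ fun i =>
    (hP i).2.2.trans_lt (hP (i + 1)).2.1
  have hinj : Function.Injective p := fun a b h => Fin.ext (hmono.injective h)
  have hlow : ∀ i, 4 * 2 ^ j < p i := fun i => by
    refine lt_of_le_of_lt ?_ (hP i).2.1
    rw [show 4 * 2 ^ j = 2 ^ (j + 2) by ring]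
    exact Nat.pow_le_pow_right two_pos (by omega)
  have hj1 : 1 ≤ 2 ^ j := Nat.one_le_two_pow
  obtain ⟨q, hqm, hcop, hns⟩ := exists_forall_not_isSquare (X := 2 ^ j) p (fun i => (hP i).1)
    (fun i => by have := hlow i; omega) hinj (fun i => by have := hlow i; omega)
    (by rw [pow_add]; omega)
  set m := ∏ i, p i with hm
  have hmpos : 0 < m := Finset.prod_pos fun i _ => (hP i).1.pos
  have hmlow : 4 * 2 ^ j < m :=
    (hlow 0).trans_le (Nat.le_of_dvd hmpos (Finset.dvd_prod_of_mem p (Finset.mem_univ 0)))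
  have hsqf : Squarefree m :=
    Finset.squarefree_prod_of_pairwise_isCoprime
      (fun a _ b _ hab => Nat.coprime_iff_isRelPrime.mp
        ((Nat.coprime_primes (hP a).1 (hP b).1).mpr (hinj.ne hab)))
      (fun i _ => (hP i).1.squarefree)
  have hq0 : 0 < q := Nat.pos_of_ne_zero fun h0 => by
    rw [h0, Nat.coprime_zero_right] at hcop; omega
  have hgood := isGood_of_squarefree hsqf hq0 (by omega) hcop (by omega) (by omega) hns
  refine ⟨m, q, by have := Nat.lt_two_pow_self (n := j); omega, hgood, ?_⟩
  have hcard := le_ncard_progression (by omega) hj1 hgood.2.2.2.2.2.2.2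
  refine le_trans ?_ hcard
  have hmup : m ≤ 2 ^ (2 * (j + 2) ^ 2) := by
    calc m ≤ ∏ _i : Fin (j + 2), 2 ^ (2 * (j + 2)) := by
          refine Finset.prod_le_prod' fun i _ => (hP i).2.2.trans ?_
          exact Nat.pow_le_pow_right two_pos (by omega)
      _ = 2 ^ (2 * (j + 2) ^ 2) := by
          rw [Finset.prod_const, Finset.card_univ, Fintype.card_fin, ← pow_mul]; ring_nf
  have hlog : Real.log (2 * (m : ℝ) ^ 2) ≤ 64 * 2 ^ j := by
    have hm0 : (0 : ℝ) < m := by exact_mod_cast hmpos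
    have hT : 2 * (m : ℝ) ^ 2 ≤ 2 ^ (4 * (j + 2) ^ 2 + 1) := by
      have : 2 * m ^ 2 ≤ 2 ^ (4 * (j + 2) ^ 2 + 1) :=
        calc 2 * m ^ 2 ≤ 2 * (2 ^ (2 * (j + 2) ^ 2)) ^ 2 := by gcongr
          _ = 2 ^ (4 * (j + 2) ^ 2 + 1) := by rw [← pow_mul, pow_succ]; ring_nf
      exact_mod_cast this
    calc Real.log (2 * (m : ℝ) ^ 2) ≤ Real.log (2 ^ (4 * (j + 2) ^ 2 + 1)) :=
          Real.log_le_log (by positivity) hT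
      _ = ((4 * (j + 2) ^ 2 + 1 : ℕ) : ℝ) * Real.log 2 := by rw [Real.log_pow]
      _ ≤ ((4 * (j + 2) ^ 2 + 1 : ℕ) : ℝ) * 1 := by
          gcongr
          linarith [Real.log_two_lt_d9]
      _ ≤ ((64 * 2 ^ j : ℕ) : ℝ) := by
          rw [mul_one]
          have := quadratic_le_two_pow j
          exact_mod_cast (by omega : 4 * (j + 2) ^ 2 + 1 ≤ 64 * 2 ^ j)
      _ = 64 * 2 ^ j := by push_cast; ring
  have hT0 : 0 ≤ (2 * (m : ℝ) ^ 2) ^ (1 / 2 : ℝ) := by positivity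
  push_cast
  calc 1 / 64 * ((2 * (m : ℝ) ^ 2) ^ (1 / 2 : ℝ) * Real.log (2 * (m : ℝ) ^ 2))
      = (2 * (m : ℝ) ^ 2) ^ (1 / 2 : ℝ) * (1 / 64 * Real.log (2 * (m : ℝ) ^ 2)) := by ring
    _ ≤ (2 * (m : ℝ) ^ 2) ^ (1 / 2 : ℝ) * (2 ^ j + 1) := by gcongr; linarith

lemma exists_isGood_seq : ∃ c : ℝ, 0 < c ∧ ∃ (T : ℕ → ℝ) (q₁ q₂ : ℕ → ℕ) (X₁ X₂ : ℕ → ℝ),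
    Filter.Tendsto T Filter.atTop Filter.atTop ∧
    ∀ i, IsGood (q₁ i) (q₂ i) (X₁ i) (X₂ i) (T i) ∧
      c * (T i ^ (1 / 2 : ℝ) * Real.log (T i)) ≤
        ((progression (q₁ i) (q₂ i) (X₁ i) (X₂ i)).ncard : ℝ) := by
  choose m q hm hgood hcard using exists_isGood_log
  refine ⟨1 / 64, by norm_num, fun j => 2 * (m j : ℝ) ^ 2, m, q, fun j => (m j : ℝ) - 1,
    fun j => ((2 ^ j : ℕ) : ℝ), ?_, fun j => ⟨hgood j, hcard j⟩⟩
  refine Filter.tendsto_atTop_mono (fun j => ?_) tendsto_natCast_atTop_atTop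
  have h : j ≤ 2 * m j ^ 2 := by nlinarith [hm j]
  exact_mod_cast h

/-! ### Consequences for admissible exponents. -/

/-- Either kind of upper exponent bounds the size of good progressions. -/
lemma exists_ncard_le_of_isGood {θ : ℝ} (h : CoprimeUpperExponent θ ∨ ProperUpperExponent θ)
    {ε : ℝ} (hε : 0 < ε) :
    ∃ C : ℝ, ∀ (q₁ q₂ : ℕ) (X₁ X₂ T : ℝ), 1 ≤ T → IsGood q₁ q₂ X₁ X₂ T →
      ((progression q₁ q₂ X₁ X₂).ncard : ℝ) ≤ C * T ^ (θ + ε) := by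
  obtain h | h := h <;> obtain ⟨C, hC⟩ := h ε hε <;>
    refine ⟨C, fun q₁ q₂ X₁ X₂ T hT ⟨h₁, h₂, hcop, hX₁, hX₂, hcont, hav, hprop⟩ => ?_⟩
  · exact hC q₁ q₂ X₁ X₂ T h₁ h₂ hcop hX₁ hX₂ hT hcont hav
  · exact hC q₁ q₂ X₁ X₂ T h₁ h₂ hprop hX₁ hX₂ hT hcont hav

lemma half_le_of_upperExponent {θ : ℝ} (h : CoprimeUpperExponent θ ∨ ProperUpperExponent θ) :
    1 / 2 ≤ θ := by
  refine le_of_forall_pos_le_add fun ε hε => ?_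
  by_contra! hlt
  obtain ⟨C, hC⟩ := exists_ncard_le_of_isGood h hε
  obtain ⟨c, hc, T, q₁, q₂, X₁, X₂, hT, hgood⟩ := exists_isGood_seq
  have hlog := Real.tendsto_log_atTop.comp hT
  obtain ⟨i, hi1, hi2⟩ := ((hT.eventually_ge_atTop 1).and
    (hlog.eventually_gt_atTop (|C| / c))).exists
  have hT0 : 0 < T i := by linarith
  have hpow : T i ^ (θ + ε) ≤ T i ^ (1 / 2 : ℝ) := Real.rpow_le_rpow_of_exponent_le hi1 hlt.le
  have hpos : 0 < T i ^ (1 / 2 : ℝ) := Real.rpow_pos_of_pos hT0 _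
  have h1 := (hgood i).2.trans (hC _ _ _ _ _ hi1 (hgood i).1)
  -- The absolute value is needed because `C` is not assumed non-negative.
  have h2 : C * T i ^ (θ + ε) ≤ |C| * T i ^ (1 / 2 : ℝ) := by
    gcongr
    exact le_abs_self C
  rw [Function.comp_apply, div_lt_iff₀ hc] at hi2
  nlinarith

/-- With `T = 2 * p ^ 2` one has `p ^ α = 2 ^ (-(α / 2)) * T ^ (α / 2)`, whence the constant. -/
lemma IsPair.rpow_le_ncard {p q : ℕ} (h : IsPair p q) {α c : ℝ}
    (hn : c * (p : ℝ) ^ α ≤ (leastNonresidue p : ℝ)) :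
    c * (2 : ℝ) ^ (-(α / 2)) * (2 * (p : ℝ) ^ 2) ^ ((1 + α) / 2) ≤
      ((progression p q ((p : ℝ) - 1) ((leastNonresidue p : ℝ) - 1)).ncard : ℝ) := by
  refine le_trans ?_ h.isGood_and_le_ncard.2
  have hp0 : (0 : ℝ) < p := by exact_mod_cast h.1.pos
  have h1 : (2 * (p : ℝ) ^ 2) ^ ((1 + α) / 2) =
      (2 * (p : ℝ) ^ 2) ^ (1 / 2 : ℝ) * (2 ^ (α / 2) * (p : ℝ) ^ α) := by
    rw [show (1 + α) / 2 = 1 / 2 + α / 2 by ring, Real.rpow_add (by positivity),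
      Real.mul_rpow (z := α / 2) zero_le_two (by positivity), ← Real.rpow_natCast_mul hp0.le]
    congr 3
    push_cast
    ring
  have h2 : (2 : ℝ) ^ (-(α / 2)) * 2 ^ (α / 2) = 1 := by
    rw [← Real.rpow_add two_pos, neg_add_cancel, Real.rpow_zero]
  calc c * (2 : ℝ) ^ (-(α / 2)) * (2 * (p : ℝ) ^ 2) ^ ((1 + α) / 2)
      = (2 * (p : ℝ) ^ 2) ^ (1 / 2 : ℝ) * (c * (p : ℝ) ^ α) *
          ((2 : ℝ) ^ (-(α / 2)) * 2 ^ (α / 2)) := by rw [h1]; ring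
    _ ≤ (2 * (p : ℝ) ^ 2) ^ (1 / 2 : ℝ) * (leastNonresidue p : ℝ) := by
        rw [h2, mul_one]; gcongr

/-- Dividing `T ^ (1/2) * n(p) ≤ C * T ^ (θ + ε / 2)` by `T ^ (1/2)` leaves a power of `T = 2 * p ^
2`, which doubles the exponent `θ + ε / 2 - 1 / 2`. -/
lemma nonresidueExponent_of_upperExponent {θ : ℝ}
    (h : CoprimeUpperExponent θ ∨ ProperUpperExponent θ) : NonresidueExponent (2 * θ - 1) := by
  intro ε hε
  obtain ⟨C, hC⟩ := exists_ncard_le_of_isGood h (half_pos hε)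
  refine ⟨C * 2 ^ (θ + ε / 2 - 1 / 2), fun p hp h4 => ?_⟩
  obtain ⟨q, hpq⟩ := exists_isPair hp h4
  have hp1 : (1 : ℝ) ≤ p := by exact_mod_cast hp.one_le
  have hp0 : (0 : ℝ) < p := by linarith
  obtain ⟨hgood, hle⟩ := hpq.isGood_and_le_ncard
  have hle := hle.trans (hC _ _ _ _ _ (by nlinarith) hgood)
  have hpos : 0 < (2 * (p : ℝ) ^ 2) ^ (1 / 2 : ℝ) := by positivity
  have h1 : (2 * (p : ℝ) ^ 2) ^ (θ + ε / 2) = (2 * (p : ℝ) ^ 2) ^ (1 / 2 : ℝ) *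
      (2 ^ (θ + ε / 2 - 1 / 2) * (p : ℝ) ^ (2 * θ - 1 + ε)) := by
    rw [show θ + ε / 2 = 1 / 2 + (θ + ε / 2 - 1 / 2) by ring, Real.rpow_add (by positivity),
      Real.mul_rpow (z := θ + ε / 2 - 1 / 2) zero_le_two (by positivity),
      ← Real.rpow_natCast_mul hp0.le, add_sub_cancel_left]
    congr 3
    push_cast
    ring
  rw [h1] at hle
  refine le_of_mul_le_mul_left (hle.trans_eq ?_) hpos
  ring

end SquareAP

theorem mainTheorem3 :
    -- the construction: for every prime `p ≡ 1 (mod 4)` a suitable `q` exists, and each such `q`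
    -- gives a progression of size `≫ T ^ (1/2) * n(p)`, where `T = 2 p ^ 2`
    (∀ p : ℕ, p.Prime → p % 4 = 1 → ∃ q : ℕ, SquareAP.IsPair p q) ∧
    (∀ p q : ℕ, SquareAP.IsPair p q →
      SquareAP.IsGood p q ((p : ℝ) - 1) ((SquareAP.leastNonresidue p : ℝ) - 1)
        (2 * (p : ℝ) ^ 2) ∧
      (2 * (p : ℝ) ^ 2) ^ (1 / 2 : ℝ) * (SquareAP.leastNonresidue p : ℝ) ≤
        ((SquareAP.progression p q ((p : ℝ) - 1)
          ((SquareAP.leastNonresidue p : ℝ) - 1)).ncard : ℝ)) ∧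
    -- the unconditional lower bound
    (∃ c : ℝ, 0 < c ∧ ∃ (T : ℕ → ℝ) (q₁ q₂ : ℕ → ℕ) (X₁ X₂ : ℕ → ℝ),
      Filter.Tendsto T Filter.atTop Filter.atTop ∧
      ∀ i, SquareAP.IsGood (q₁ i) (q₂ i) (X₁ i) (X₂ i) (T i) ∧
        c * (T i ^ (1 / 2 : ℝ) * Real.log (T i)) ≤
          ((SquareAP.progression (q₁ i) (q₂ i) (X₁ i) (X₂ i)).ncard : ℝ)) ∧
    -- no exponent below `1/2` is possible
    (∀ θ : ℝ, SquareAP.CoprimeUpperExponent θ ∨ SquareAP.ProperUpperExponent θ → 1 / 2 ≤ θ) ∧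
    -- the conditional lower bound
    (∀ α c : ℝ, 0 < c → ∃ c' : ℝ, 0 < c' ∧ (
      {p : ℕ | p.Prime ∧ p % 4 = 1 ∧
        c * (p : ℝ) ^ α ≤ (SquareAP.leastNonresidue p : ℝ)}.Infinite →
      ∀ T₀ : ℝ, ∃ (T : ℝ) (p q : ℕ), T₀ ≤ T ∧ T = 2 * (p : ℝ) ^ 2 ∧ SquareAP.IsPair p q ∧
        SquareAP.IsGood p q ((p : ℝ) - 1) ((SquareAP.leastNonresidue p : ℝ) - 1) T ∧
        c' * T ^ ((1 + α) / 2) ≤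
          ((SquareAP.progression p q ((p : ℝ) - 1)
            ((SquareAP.leastNonresidue p : ℝ) - 1)).ncard : ℝ))) ∧
    -- an exponent below `1/2 + 1/(8 √e)` improves Burgess's bound for primes `p ≡ 1 (mod 4)`
    (∀ θ : ℝ, θ < 1 / 2 + 1 / (8 * √(Real.exp 1)) →
      SquareAP.CoprimeUpperExponent θ ∨ SquareAP.ProperUpperExponent θ →
      ∃ β : ℝ, β < 1 / (4 * √(Real.exp 1)) ∧ SquareAP.NonresidueExponent β) := by
  refine ⟨fun p hp h4 => SquareAP.exists_isPair hp h4, fun p q h => h.isGood_and_le_ncard,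
    SquareAP.exists_isGood_seq, fun θ h => SquareAP.half_le_of_upperExponent h,
    fun α c hc => ⟨c * 2 ^ (-(α / 2)), by positivity, fun hinf T₀ => ?_⟩, fun θ hθ h =>
      ⟨2 * θ - 1, ?_, SquareAP.nonresidueExponent_of_upperExponent h⟩⟩
  · obtain ⟨p, ⟨hp, h4, hn⟩, hlt⟩ := hinf.exists_gt ⌈T₀⌉₊
    obtain ⟨q, hpq⟩ := SquareAP.exists_isPair hp h4
    refine ⟨2 * (p : ℝ) ^ 2, p, q, ?_, rfl, hpq, hpq.isGood_and_le_ncard.1,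
      hpq.rpow_le_ncard hn⟩
    have h₁ : T₀ ≤ p := (Nat.le_ceil T₀).trans (by exact_mod_cast hlt.le)
    have h₂ : (1 : ℝ) ≤ p := by exact_mod_cast hp.one_le
    nlinarith
  -- The threshold for `θ` is exactly where `2 * θ - 1` meets Burgess's exponent.
  · have h : 1 / (4 * √(Real.exp 1)) = 2 * (1 / (8 * √(Real.exp 1))) := by ring
    rw [h]
    linarith
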